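/- Let $X_1,X_2,\dots$ be an infinite sequence of i.i.d. real random variables and let $h:\mathbb R^2\to\mathbb R$ be measurable and symmetric. Let $d>2$ be real and let $m=m(n)$ be a sequence of positive integers with $m(n)\to\infty$ as $n\to\infty$ which is at least of the order $n^{d/(d-2)}(\log n)^{(d+2)/(d-2)}$, that is, for some constant $C$, $$n^{d/(d-2)}(\log n)^{(d+2)/(d-2)}\le C\,m(n)\quad\text{for all large } n$$ (in particular, $m(n)$ may be of exact order $n^{d/(d-2)}(\log n)^{(d+2)/(d-2)}$). For each $n\ge 1$ draw indices $I_{n,1},\dots,I_{n,m}$, $m=m(n)$, independently and uniformly with replacement from $\{1,\dots,n\}$, independently of $X_1,\dots,X_n$ (the $X_i$ and all the draws being defined on one probability space with probability $P_{X,w}$, and no assumption being made on the joint law of the draws for different $n$). Put $X^*_s=X_{I_{n,s}}$, let $w^{(n)}_i$ be the number of $s\le m$ with $I_{n,s}=i$, and define $$U^*_{n,m}=\frac{1}{m(m-1)}\sum_{\substack{1\le s,t\le m\\ I_{n,s}\ne I_{n,t}}}h(X^*_s,X^*_t)=\frac{1}{m(m-1)}\sum_{1\le i\ne j\le n}w^{(n)}_iw^{(n)}_j\,h(X_i,X_j).$$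 (a) If $E|h(X_1,X_2)|^{2/d}<\infty$, then, as $n\to\infty$, $m^{-d+2}\,U^*_{n,m}\to 0$ almost surely with respect to the joint probability $P_{X,w}$. (b) If $E|h(X_1,X_2)|^{2/d}<\infty$ and $E|h(X_1,X_1)|^{2/d}<\infty$, then, as $n\to\infty$, $m^{-d+2}\,V^*_{n,m}\to 0$ almost surely with respect to $P_{X,w}$, for each of the two versions of the bootstrap $v$-statistic $$V^*_{n,m}=\frac{1}{m(m-1)}\sum_{1\le s\ne t\le m}h(X^*_s,X^*_t)\qquad\text{and}\qquad V^*_{n,m}=\frac{1}{m(m-1)}\sum_{1\le i,j\le n}w^{(n)}_iw^{(n)}_j\,h(X_i,X_j).$$ -/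

import Mathlib

open MeasureTheory ProbabilityTheory Filter Topology Asymptotics

namespace BootstrapUV

/-- One round of the `m`-out-of-`n` bootstrap scheme: the indices `I 0, …, I (m-1)` are drawn with
replacement (independently and uniformly) from the set `{0, …, n-1}` of the indices of the
observations `X 0, …, X (n-1)`, independently of these observations.
The joint law of different rounds is not restricted. -/
structure IsMOutOfN {Ω : Type*} [MeasurableSpace Ω] (P : Measure Ω) (X : ℕ → Ω → ℝ)
    (n m : ℕ) (I : Fin m → Ω → ℕ) : Prop where
  measurable : ∀ s, Measurable (I s)
  uniform : ∀ s, P.map (I s) = uniformOn (Set.Iio n)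
  indep : iIndepFun I P
  indep_data : IndepFun (fun ω (i : Fin n) => X i ω) (fun ω s => I s ω) P

/-- The bootstrap weight `w_i`: the number of times the index `i` is chosen. -/
def weight {m : ℕ} (idx : Fin m → ℕ) (i : ℕ) : ℕ :=
  (Finset.univ.filter fun s => idx s = i).card

/-- The bootstrap `u`-statistic: the sum of `h (X*_s, X*_t)` over all pairs of draws `s, t` that
picked distinct observations (that is, distinct indices), divided by `m (m - 1)`.
Here `x` is the data and `X*_s = x (idx s)`. -/
noncomputable def bootU (h : ℝ → ℝ → ℝ) (x : ℕ → ℝ) {m : ℕ} (idx : Fin m → ℕ) : ℝ :=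
  (∑ s : Fin m, ∑ t : Fin m, if idx s ≠ idx t then h (x (idx s)) (x (idx t)) else 0) /
    ((m : ℝ) * ((m : ℝ) - 1))

/-- The bootstrap `v`-statistic as a sum over pairs of draws `s ≠ t`. -/
noncomputable def bootV (h : ℝ → ℝ → ℝ) (x : ℕ → ℝ) {m : ℕ} (idx : Fin m → ℕ) : ℝ :=
  (∑ s : Fin m, ∑ t : Fin m, if s ≠ t then h (x (idx s)) (x (idx t)) else 0) /
    ((m : ℝ) * ((m : ℝ) - 1))

/-- The bootstrap `v`-statistic in its weighted form,
`∑_{i, j < n} w_i w_j h (X_i, X_j) / (m (m - 1))`, the diagonal terms included. -/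
noncomputable def bootVWeighted (h : ℝ → ℝ → ℝ) (x : ℕ → ℝ) (n : ℕ) {m : ℕ}
    (idx : Fin m → ℕ) : ℝ :=
  (∑ i ∈ Finset.range n, ∑ j ∈ Finset.range n,
      (weight idx i : ℝ) * (weight idx j : ℝ) * h (x i) (x j)) /
    ((m : ℝ) * ((m : ℝ) - 1))

end BootstrapUV

namespace BootstrapUV

/-! ### Almost sure growth of monotone sums. -/

section Growth

variable {Ω : Type*} [MeasurableSpace Ω] {P : Measure Ω}

/-! The draws need no probabilistic treatment: every value of `h` entering the statistic is one of
the summands of `T = ∑ |h (X i) (X j)|`, so the statistic is at most `2 * T` in absolute value,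
whatever the draws. With `p = 2 / d < 1`, subadditivity of `t ^ p` gives `T ^ p ≤ S`, where `S n = ∑
|h (X i) (X j)| ^ p` has at most `n ^ 2` terms of bounded mean. Since `S` is monotone, summing
expectations along `n = 2 ^ k` yields `S n = o(n ^ 2 * log n ^ 2)` almost surely
(`ae_tendsto_div_sq_mul_log_sq`). The growth of `m` gives `m ^ ((2 - d) * p) = O(1 / (n ^ 2 * log n
^ 2))` (`exists_eventually_rpow_le_of_order`), and `ae_tendsto_of_abs_le_sum` combines the two. -/

lemma ae_tendsto_zero_of_summable_integral {f : ℕ → Ω → ℝ} (hf0 : ∀ k ω, 0 ≤ f k ω)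
    (hf : ∀ k, Integrable (f k) P) (hsum : Summable fun k => ∫ ω, f k ω ∂P) :
    ∀ᵐ ω ∂P, Tendsto (fun k => f k ω) atTop (𝓝 0) := by
  have hmeas : ∀ k, AEMeasurable (fun ω => ENNReal.ofReal (f k ω)) P :=
    fun k => (hf k).aemeasurable.ennreal_ofReal
  have htsum : ∫⁻ ω, ∑' k, ENNReal.ofReal (f k ω) ∂P ≠ ⊤ := by
    rw [lintegral_tsum hmeas]
    have : ∀ k, ∫⁻ ω, ENNReal.ofReal (f k ω) ∂P = ENNReal.ofReal (∫ ω, f k ω ∂P) :=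
      fun k => (ofReal_integral_eq_lintegral_ofReal (hf k) (ae_of_all _ (hf0 k))).symm
    simp_rw [this]
    exact hsum.tsum_ofReal_ne_top
  filter_upwards [ae_lt_top' (AEMeasurable.tsum hmeas) htsum] with ω hω
  have h1 := ENNReal.tendsto_atTop_zero_of_tsum_ne_top hω.ne
  have h2 := (ENNReal.tendsto_toReal ENNReal.zero_ne_top).comp h1
  simpa [Function.comp_def, ENNReal.toReal_ofReal, hf0] using h2

lemma tendsto_div_sq_mul_log_sq {S : ℕ → ℝ} (hS0 : ∀ n, 0 ≤ S n) (hS : Monotone S)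
    (hdyadic : Tendsto (fun k : ℕ => S (2 ^ k) / (4 ^ k * (k : ℝ) ^ 2)) atTop (𝓝 0)) :
    Tendsto (fun n : ℕ => S n / ((n : ℝ) ^ 2 * Real.log n ^ 2)) atTop (𝓝 0) := by
  have hlog : Tendsto (fun n : ℕ => Nat.log 2 n + 1) atTop atTop := by
    refine tendsto_atTop_mono' (f₁ := fun n => Nat.log 2 n) _ (Eventually.of_forall fun n => by simp) ?_
    refine tendsto_atTop.2 fun b => ?_
    filter_upwards [eventually_ge_atTop (2 ^ b)] with n hn
    exact Nat.le_log_of_pow_le one_lt_two hn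
  -- Here `64 = 4 * 16`, from `4 ^ (k + 1) ≤ 4 * n ^ 2` and `(k + 1) ^ 2 ≤ 16 * log n ^ 2`.
  have hup := (hdyadic.comp hlog).const_mul 64
  rw [mul_zero] at hup
  refine squeeze_zero' (Eventually.of_forall fun n => by have := hS0 n; positivity) ?_ hup
  filter_upwards [eventually_ge_atTop 2] with n hn
  set k := Nat.log 2 n with hk
  have hn0 : n ≠ 0 := by omega
  have hnk : n ≤ 2 ^ (k + 1) := (Nat.lt_pow_succ_log_self one_lt_two n).le
  have hkn : 2 ^ k ≤ n := Nat.pow_log_le_self 2 hn0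
  have hk1 : 1 ≤ k := Nat.le_log_of_pow_le one_lt_two (by simpa using hn)
  have hknR : (2 : ℝ) ^ k ≤ n := by exact_mod_cast hkn
  have hk1R : (1 : ℝ) ≤ k := by exact_mod_cast hk1
  have hlogn : (k : ℝ) * (1 / 2) ≤ Real.log n := by
    have h1 : Real.log ((2 : ℝ) ^ k) ≤ Real.log n := Real.log_le_log (by positivity) hknR
    rw [Real.log_pow] at h1
    have h2 : (1 / 2 : ℝ) ≤ Real.log 2 := by linarith [Real.log_two_gt_d9]
    nlinarith
  have hlogpos : 0 < Real.log n := by linarith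
  have hnpos : (0 : ℝ) < n := by positivity
  have hA : (4 : ℝ) ^ (k + 1) ≤ 4 * (n : ℝ) ^ 2 := by
    have : (4 : ℝ) ^ k = (2 ^ k) ^ 2 := by rw [← pow_mul, mul_comm, pow_mul]; norm_num
    rw [pow_succ, this]
    nlinarith [pow_le_pow_left₀ (by positivity) hknR 2]
  have hB : ((k : ℝ) + 1) ^ 2 ≤ 16 * Real.log n ^ 2 := by
    have : (k : ℝ) + 1 ≤ 4 * Real.log n := by linarith
    nlinarith [pow_le_pow_left₀ (by positivity) this 2]
  have hAB : (4 : ℝ) ^ (k + 1) * ((k : ℝ) + 1) ^ 2 ≤ 64 * ((n : ℝ) ^ 2 * Real.log n ^ 2) := by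
    calc _ ≤ (4 * (n : ℝ) ^ 2) * (16 * Real.log n ^ 2) := by gcongr
      _ = _ := by ring
  have hSn := hS hnk
  simp only [Function.comp_apply, Nat.cast_add, Nat.cast_one]
  rw [← mul_div_assoc, div_le_div_iff₀ (by positivity) (by positivity)]
  calc _ ≤ S (2 ^ (k + 1)) * (64 * ((n : ℝ) ^ 2 * Real.log n ^ 2)) :=
        mul_le_mul hSn hAB (by positivity) (hS0 _)
    _ = _ := by ring

/-- At `n = 2 ^ k` the normalized expectation is at most `K / k ^ 2`; the squared logarithm is what
makes this summable. -/
lemma ae_tendsto_div_sq_mul_log_sq {S : ℕ → Ω → ℝ} (hS0 : ∀ n ω, 0 ≤ S n ω)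
    (hS : ∀ ω, Monotone fun n => S n ω) (hint : ∀ n, Integrable (S n) P) {K : ℝ}
    (hK : ∀ n : ℕ, ∫ ω, S n ω ∂P ≤ (n : ℝ) ^ 2 * K) :
    ∀ᵐ ω ∂P, Tendsto (fun n : ℕ => S n ω / ((n : ℝ) ^ 2 * Real.log n ^ 2)) atTop (𝓝 0) := by
  have hsum : Summable fun k : ℕ => ∫ ω, S (2 ^ k) ω / (4 ^ k * (k : ℝ) ^ 2) ∂P := by
    have hs : Summable fun k : ℕ => K * (1 / (k : ℝ) ^ 2) :=
      (Real.summable_one_div_nat_pow.2 one_lt_two).mul_left K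
    refine hs.of_nonneg_of_le
      (fun k => integral_nonneg fun ω => div_nonneg (hS0 (2 ^ k) ω) (by positivity)) fun k => ?_
    rw [integral_div]
    -- At `k = 0` both sides vanish, division by zero being zero.
    rcases Nat.eq_zero_or_pos k with rfl | hk
    · simp
    have hkR : (0 : ℝ) < k := by exact_mod_cast hk
    rw [div_le_iff₀ (by positivity)]
    refine (hK (2 ^ k)).trans_eq ?_
    have : (4 : ℝ) ^ k = (2 ^ k) ^ 2 := by rw [← pow_mul, mul_comm, pow_mul]; norm_num
    push_cast
    rw [this]
    field_simp
  filter_upwards [ae_tendsto_zero_of_summable_integral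
    (fun k ω => div_nonneg (hS0 (2 ^ k) ω) (by positivity))
    (fun k => (hint (2 ^ k)).div_const (4 ^ k * (k : ℝ) ^ 2)) hsum] with ω hω
  exact tendsto_div_sq_mul_log_sq (fun n => hS0 n ω) (hS ω) hω

end Growth

lemma sum_le_rpow_sum_rpow {ι : Type*} (s : Finset ι) {f : ι → ℝ} (hf : ∀ i, 0 ≤ f i) {p : ℝ}
    (hp0 : 0 < p) (hp1 : p ≤ 1) : ∑ i ∈ s, f i ≤ (∑ i ∈ s, f i ^ p) ^ p⁻¹ := by
  rw [Real.le_rpow_inv_iff_of_pos (Finset.sum_nonneg fun i _ => hf i)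
    (Finset.sum_nonneg fun i _ => Real.rpow_nonneg (hf i) p) hp0]
  lift f to ι → NNReal using hf
  have h := Finset.le_sum_of_subadditive (fun a : NNReal => a ^ p)
    (NNReal.zero_rpow hp0.ne').le (fun a b => NNReal.rpow_add_le_add_rpow a b hp0.le hp1) s f
  simp only
  exact_mod_cast h

/-- Raising the order condition to the power `q = (d - 2) * (2 / d)` turns the exponent of `n` into
exactly 2 and that of `log n` into `2 + 4 / d`. The surplus is dropped, as `log n ≥ 1` for `n ≥ 3`.
-/
lemma exists_eventually_rpow_le_of_order {d : ℝ} (hd : 2 < d) {m : ℕ → ℕ} (hm_top : Tendsto m atTop atTop)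
    (hm_order : (fun n : ℕ => (n : ℝ) ^ (d / (d - 2)) * Real.log n ^ ((d + 2) / (d - 2)))
      =O[atTop] (fun n : ℕ => (m n : ℝ))) :
    ∃ C : ℝ, 0 ≤ C ∧ ∀ᶠ n : ℕ in atTop,
      (m n : ℝ) ^ ((-d + 2) * (2 / d)) ≤ C * ((n : ℝ) ^ 2 * Real.log n ^ 2)⁻¹ := by
  obtain ⟨c, hc, hbound⟩ := hm_order.exists_pos
  have hd2 : 0 < d - 2 := by linarith
  have hd0 : 0 < d := by linarith
  set q : ℝ := (d - 2) * (2 / d) with hq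
  have hq0 : 0 < q := by positivity
  refine ⟨c ^ q, by positivity, ?_⟩
  filter_upwards [hbound.bound, eventually_ge_atTop 3, hm_top.eventually_ge_atTop 1]
    with n hn hn3 hm1
  have hn3R : (3 : ℝ) ≤ n := by exact_mod_cast hn3
  have hn0 : (0 : ℝ) < n := by linarith
  have hm0 : (0 : ℝ) < m n := by exact_mod_cast hm1
  have hlog : 1 ≤ Real.log n := by
    rw [Real.le_log_iff_exp_le hn0]
    linarith [Real.exp_one_lt_d9]
  have hlog0 : 0 ≤ Real.log n := by linarith
  rw [Real.norm_of_nonneg (by positivity), Real.norm_of_nonneg hm0.le] at hn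
  have hpow := Real.rpow_le_rpow (by positivity) hn hq0.le
  rw [Real.mul_rpow (by positivity) (by positivity), Real.mul_rpow hc.le hm0.le,
    ← Real.rpow_mul hn0.le, ← Real.rpow_mul hlog0] at hpow
  have e1 : d / (d - 2) * q = 2 := by rw [hq]; field_simp
  have e2 : (2 : ℝ) ≤ (d + 2) / (d - 2) * q := by
    have : (d + 2) / (d - 2) * q = 2 + 4 / d := by rw [hq]; field_simp; ring
    rw [this]
    have : 0 < 4 / d := by positivity
    linarith
  have hl2 : Real.log n ^ 2 ≤ Real.log n ^ ((d + 2) / (d - 2) * q) := by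
    rw [← Real.rpow_natCast]
    exact Real.rpow_le_rpow_of_exponent_le hlog (by exact_mod_cast e2)
  rw [e1, Real.rpow_two] at hpow
  have hfin : (n : ℝ) ^ 2 * Real.log n ^ 2 ≤ c ^ q * (m n : ℝ) ^ q :=
    (mul_le_mul_of_nonneg_left hl2 (by positivity)).trans hpow
  have e3 : (-d + 2) * (2 / d) = -q := by rw [hq]; ring
  have hmq : 0 < (m n : ℝ) ^ q := by positivity
  rw [e3, Real.rpow_neg hm0.le, ← div_eq_mul_inv, inv_eq_one_div,
    div_le_div_iff₀ hmq (by positivity), one_mul]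
  exact hfin

/-- Any statistic dominated by the sum of `|f p|` over at most `n ^ 2` terms with uniformly bounded
moments of order `2 / d` is negligible under the normalization `m ^ (-d + 2)`. -/
lemma ae_tendsto_of_abs_le_sum {Ω : Type*} [MeasurableSpace Ω] {P : Measure Ω} {d : ℝ} (hd : 2 < d)
    {m : ℕ → ℕ} (hm_top : Tendsto m atTop atTop)
    (hm_order : (fun n : ℕ => (n : ℝ) ^ (d / (d - 2)) * Real.log n ^ ((d + 2) / (d - 2)))
      =O[atTop] (fun n : ℕ => (m n : ℝ)))
    {ι : Type*} {A : ℕ → Finset ι} (hA : Monotone A) (hcard : ∀ n, (A n).card ≤ n ^ 2)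
    {f : ι → Ω → ℝ} {K : ℝ} (hK0 : 0 ≤ K)
    (hint : ∀ n, ∀ p ∈ A n, Integrable (fun ω => |f p ω| ^ (2 / d)) P)
    (hK : ∀ n, ∀ p ∈ A n, ∫ ω, |f p ω| ^ (2 / d) ∂P ≤ K) {Z : ℕ → Ω → ℝ}
    (hZ : ∀ᵐ ω ∂P, ∀ᶠ n in atTop, |Z n ω| ≤ 2 * ∑ p ∈ A n, |f p ω|) :
    ∀ᵐ ω ∂P, Tendsto (fun n => (m n : ℝ) ^ (-d + 2) * Z n ω) atTop (𝓝 0) := by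
  have hd0 : 0 < d := by linarith
  have hterm : ∀ p ω, 0 ≤ |f p ω| ^ (2 / d) := fun p ω => by positivity
  obtain ⟨C, hC0, hC⟩ := exists_eventually_rpow_le_of_order hd hm_top hm_order
  have hS := ae_tendsto_div_sq_mul_log_sq (P := P) (S := fun n ω => ∑ p ∈ A n, |f p ω| ^ (2 / d))
    (K := K) (fun n ω => Finset.sum_nonneg fun p _ => hterm p ω)
    (fun ω a b hab => Finset.sum_le_sum_of_subset_of_nonneg (hA hab) fun p _ _ => hterm p ω)
    (fun n => integrable_finsetSum _ (hint n))
    (fun n => by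
      rw [integral_finsetSum _ (hint n)]
      refine (Finset.sum_le_card_nsmul _ _ K (hK n)).trans ?_
      rw [nsmul_eq_mul]
      gcongr
      exact_mod_cast hcard n)
  filter_upwards [hS, hZ] with ω hSω hZω
  have hlim : Tendsto (fun n : ℕ => 2 * (C * ((∑ p ∈ A n, |f p ω| ^ (2 / d)) /
      ((n : ℝ) ^ 2 * Real.log n ^ 2))) ^ (d / 2)) atTop (𝓝 0) := by
    have h1 := ((hSω.const_mul C).rpow_const (p := d / 2) (Or.inr (by positivity))).const_mul 2
    rwa [mul_zero, Real.zero_rpow (by positivity), mul_zero] at h1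
  refine squeeze_zero_norm' ?_ hlim
  filter_upwards [hZω, hC] with n hZn hCn
  set S := ∑ p ∈ A n, |f p ω| ^ (2 / d) with hSdef
  have hS0 : 0 ≤ S := Finset.sum_nonneg fun p _ => hterm p ω
  have hsum : ∑ p ∈ A n, |f p ω| ≤ S ^ (d / 2) := by
    have := sum_le_rpow_sum_rpow (A n) (fun p => abs_nonneg (f p ω)) (p := 2 / d) (by positivity)
      (by rw [div_le_one hd0]; exact hd.le)
    rwa [inv_div] at this
  have hm0 : (0 : ℝ) ≤ m n := Nat.cast_nonneg _
  -- Written as a `d / 2` power, the normalization can be moved inside `S ^ (d / 2)`.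
  have hsplit : (m n : ℝ) ^ (-d + 2) = ((m n : ℝ) ^ ((-d + 2) * (2 / d))) ^ (d / 2) := by
    rw [← Real.rpow_mul hm0]
    congr 1
    field_simp
  rw [norm_mul, Real.norm_of_nonneg (by positivity), Real.norm_eq_abs]
  calc (m n : ℝ) ^ (-d + 2) * |Z n ω|
      ≤ (m n : ℝ) ^ (-d + 2) * (2 * S ^ (d / 2)) := by
        gcongr
        exact hZn.trans (mul_le_mul_of_nonneg_left hsum zero_le_two)
    _ = 2 * ((m n : ℝ) ^ ((-d + 2) * (2 / d)) * S) ^ (d / 2) := by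
        rw [Real.mul_rpow (by positivity) hS0, ← hsplit]; ring
    _ ≤ 2 * (C * (S / ((n : ℝ) ^ 2 * Real.log n ^ 2))) ^ (d / 2) := by
        have hmul := mul_le_mul_of_nonneg_right hCn hS0
        rw [mul_assoc, inv_mul_eq_div] at hmul
        exact mul_le_mul_of_nonneg_left
          (Real.rpow_le_rpow (by positivity) hmul (by positivity)) zero_le_two

/-! ### Bounds valid for every outcome of the draws. -/

section Deterministic

variable {m : ℕ} {T : ℝ}

lemma abs_div_le_two_mul (hm : 2 ≤ m) (hT : 0 ≤ T) {a : ℝ} (ha : |a| ≤ (m : ℝ) * m * T) :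
    |a / ((m : ℝ) * ((m : ℝ) - 1))| ≤ 2 * T := by
  have hmR : (2 : ℝ) ≤ m := by exact_mod_cast hm
  have hden : 0 < (m : ℝ) * ((m : ℝ) - 1) := mul_pos (by linarith) (by linarith)
  rw [abs_div, abs_of_pos hden, div_le_iff₀ hden]
  refine ha.trans ?_
  have : (m : ℝ) * m ≤ 2 * ((m : ℝ) * ((m : ℝ) - 1)) := by nlinarith
  nlinarith [mul_le_mul_of_nonneg_right this hT]

lemma abs_sum_sum_le {F : Fin m → Fin m → ℝ} (hF : ∀ s t, |F s t| ≤ T) :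
    |∑ s, ∑ t, F s t| ≤ (m : ℝ) * m * T := by
  calc |∑ s, ∑ t, F s t| ≤ ∑ s, ∑ t, |F s t| :=
        (Finset.abs_sum_le_sum_abs _ _).trans
          (Finset.sum_le_sum fun s _ => Finset.abs_sum_le_sum_abs _ _)
    _ ≤ ∑ _s : Fin m, ∑ _t : Fin m, T :=
        Finset.sum_le_sum fun s _ => Finset.sum_le_sum fun t _ => hF s t
    _ = _ := by simp [mul_assoc]

variable (h : ℝ → ℝ → ℝ) (x : ℕ → ℝ) {n : ℕ} {idx : Fin m → ℕ}

lemma abs_bootU_le (hm : 2 ≤ m) (hidx : ∀ s, idx s < n) :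
    |bootU h x idx| ≤ 2 * ∑ p ∈ (Finset.range n).offDiag, |h (x p.1) (x p.2)| := by
  have hT : 0 ≤ ∑ p ∈ (Finset.range n).offDiag, |h (x p.1) (x p.2)| :=
    Finset.sum_nonneg fun _ _ => abs_nonneg _
  refine abs_div_le_two_mul hm hT (abs_sum_sum_le fun s t => ?_)
  split_ifs with hst
  · exact Finset.single_le_sum (f := fun p : ℕ × ℕ => |h (x p.1) (x p.2)|)
      (fun _ _ => abs_nonneg _) (a := (idx s, idx t)) (by simp [hidx, hst])
  · simpa using hT

lemma abs_bootV_le (hm : 2 ≤ m) (hidx : ∀ s, idx s < n) :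
    |bootV h x idx| ≤ 2 * ∑ p ∈ Finset.range n ×ˢ Finset.range n, |h (x p.1) (x p.2)| := by
  have hT : 0 ≤ ∑ p ∈ Finset.range n ×ˢ Finset.range n, |h (x p.1) (x p.2)| :=
    Finset.sum_nonneg fun _ _ => abs_nonneg _
  refine abs_div_le_two_mul hm hT (abs_sum_sum_le fun s t => ?_)
  split_ifs with hst
  · exact Finset.single_le_sum (f := fun p : ℕ × ℕ => |h (x p.1) (x p.2)|)
      (fun _ _ => abs_nonneg _) (a := (idx s, idx t)) (by simp [hidx])
  · simpa using hT

lemma weight_le (idx : Fin m → ℕ) (i : ℕ) : weight idx i ≤ m :=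
  (Finset.card_filter_le _ _).trans_eq (by simp)

lemma abs_bootVWeighted_le (idx : Fin m → ℕ) (hm : 2 ≤ m) :
    |bootVWeighted h x n idx| ≤
      2 * ∑ p ∈ Finset.range n ×ˢ Finset.range n, |h (x p.1) (x p.2)| := by
  refine abs_div_le_two_mul hm (Finset.sum_nonneg fun _ _ => abs_nonneg _) ?_
  rw [← Finset.sum_product', Finset.mul_sum]
  -- Termwise, the product of two weights is at most `m * m`.
  refine (Finset.abs_sum_le_sum_abs _ _).trans (Finset.sum_le_sum fun p _ => ?_)
  rw [abs_mul, abs_of_nonneg (by positivity)]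
  have h1 : (weight idx p.1 : ℝ) ≤ m := by exact_mod_cast weight_le idx p.1
  have h2 : (weight idx p.2 : ℝ) ≤ m := by exact_mod_cast weight_le idx p.2
  gcongr

end Deterministic

/-! ### Laws of the draws and of pairs of observations. -/

lemma IsMOutOfN.ae_lt {Ω : Type*} [MeasurableSpace Ω] {P : Measure Ω} {X : ℕ → Ω → ℝ} {n m : ℕ}
    {I : Fin m → Ω → ℕ} (hI : IsMOutOfN P X n m I) : ∀ᵐ ω ∂P, ∀ s, I s ω < n := by
  rw [ae_all_iff]
  intro s
  have h1 : ∀ᵐ k ∂(P.map (I s)), k < n := by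
    rw [hI.uniform s]
    exact ae_cond_mem (MeasurableSet.of_discrete (s := Set.Iio n))
  exact ae_of_ae_map (hI.measurable s).aemeasurable h1

lemma identDistrib_pair {Ω : Type*} [MeasurableSpace Ω] {P : Measure Ω} [IsProbabilityMeasure P]
    {X : ℕ → Ω → ℝ} (hX_meas : ∀ i, Measurable (X i)) (hX_indep : iIndepFun X P)
    (hX_ident : ∀ i, IdentDistrib (X i) (X 0) P P) {i j : ℕ} (hij : i ≠ j) :
    IdentDistrib (fun ω => (X i ω, X j ω)) (fun ω => (X 0 ω, X 1 ω)) P P := by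
  refine ⟨by fun_prop, by fun_prop, ?_⟩
  rw [(indepFun_iff_map_prod_eq_prod_map_map (hX_meas i).aemeasurable
      (hX_meas j).aemeasurable).1 (hX_indep.indepFun hij),
    (indepFun_iff_map_prod_eq_prod_map_map (hX_meas 0).aemeasurable
      (hX_meas 1).aemeasurable).1 (hX_indep.indepFun zero_ne_one),
    (hX_ident i).map_eq, (hX_ident j).map_eq, (hX_ident 1).map_eq]

end BootstrapUV

theorem mainTheorem3 {Ω : Type*} [MeasurableSpace Ω] (P : Measure Ω) [IsProbabilityMeasure P]
    (X : ℕ → Ω → ℝ) (hX_meas : ∀ i, Measurable (X i)) (hX_indep : iIndepFun X P)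
    (hX_ident : ∀ i, IdentDistrib (X i) (X 0) P P)
    (h : ℝ → ℝ → ℝ) (h_meas : Measurable (Function.uncurry h)) (h_symm : ∀ x y, h x y = h y x)
    (d : ℝ) (hd : 2 < d)
    (m : ℕ → ℕ) (hm_top : Tendsto m atTop atTop)
    (hm_order : (fun n : ℕ => (n : ℝ) ^ (d / (d - 2)) * Real.log n ^ ((d + 2) / (d - 2)))
      =O[atTop] (fun n : ℕ => (m n : ℝ)))
    (I : (n : ℕ) → Fin (m n) → Ω → ℕ)
    (hI : ∀ n, 1 ≤ n → BootstrapUV.IsMOutOfN P X n (m n) (I n))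
    (h_mom : Integrable (fun ω => |h (X 0 ω) (X 1 ω)| ^ (2 / d)) P) :
    (∀ᵐ ω ∂P, Tendsto
      (fun n : ℕ => (m n : ℝ) ^ (-d + 2) *
        BootstrapUV.bootU h (fun i => X i ω) (fun s => I n s ω))
      atTop (𝓝 0)) ∧
    (Integrable (fun ω => |h (X 0 ω) (X 0 ω)| ^ (2 / d)) P →
      (∀ᵐ ω ∂P, Tendsto
        (fun n : ℕ => (m n : ℝ) ^ (-d + 2) *
          BootstrapUV.bootV h (fun i => X i ω) (fun s => I n s ω))
        atTop (𝓝 0)) ∧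
      (∀ᵐ ω ∂P, Tendsto
        (fun n : ℕ => (m n : ℝ) ^ (-d + 2) *
          BootstrapUV.bootVWeighted h (fun i => X i ω) n (fun s => I n s ω))
        atTop (𝓝 0))) := by
  have hpow : Measurable fun y : ℝ => |y| ^ (2 / d) := by fun_prop
  have hoff : ∀ i j : ℕ, i ≠ j → IdentDistrib (fun ω => |h (X i ω) (X j ω)| ^ (2 / d))
      (fun ω => |h (X 0 ω) (X 1 ω)| ^ (2 / d)) P P := fun i j hij =>
    (BootstrapUV.identDistrib_pair hX_meas hX_indep hX_ident hij).comp (hpow.comp h_meas)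
  have hdiag : ∀ i : ℕ, IdentDistrib (fun ω => |h (X i ω) (X i ω)| ^ (2 / d))
      (fun ω => |h (X 0 ω) (X 0 ω)| ^ (2 / d)) P P := fun i =>
    (hX_ident i).comp (hpow.comp (h_meas.comp (measurable_id.prodMk measurable_id)))
  have hidx : ∀ᵐ ω ∂P, ∀ n, 1 ≤ n → ∀ s, I n s ω < n := by
    rw [ae_all_iff]
    intro n
    by_cases hn : 1 ≤ n
    · filter_upwards [(hI n hn).ae_lt] with ω hω _ using hω
    · exact ae_of_all _ fun ω hn' => absurd hn' hn
  have hm2 := hm_top.eventually_ge_atTop 2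
  refine ⟨?_, fun h_diag => ?_⟩
  · refine BootstrapUV.ae_tendsto_of_abs_le_sum hd hm_top hm_order
      (A := fun n => (Finset.range n).offDiag) (f := fun p ω => h (X p.1 ω) (X p.2 ω))
      (K := ∫ ω, |h (X 0 ω) (X 1 ω)| ^ (2 / d) ∂P)
      (fun a b hab => Finset.offDiag_mono (Finset.range_mono hab))
      (fun n => by simp [Finset.offDiag_card, sq])
      (integral_nonneg fun ω => by positivity)
      (fun n p hp => ((hoff _ _ (Finset.mem_offDiag.1 hp).2.2).integrable_iff).2 h_mom)
      (fun n p hp => (hoff _ _ (Finset.mem_offDiag.1 hp).2.2).integral_eq.le) ?_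
    filter_upwards [hidx] with ω hω
    filter_upwards [hm2, eventually_ge_atTop 1] with n hmn hn
    exact BootstrapUV.abs_bootU_le h _ hmn (hω n hn)
  have hfull : ∀ {Z : ℕ → Ω → ℝ}, (∀ᵐ ω ∂P, ∀ᶠ n in atTop, |Z n ω| ≤
      2 * ∑ p ∈ Finset.range n ×ˢ Finset.range n, |h (X p.1 ω) (X p.2 ω)|) →
      ∀ᵐ ω ∂P, Tendsto (fun n => (m n : ℝ) ^ (-d + 2) * Z n ω) atTop (𝓝 0) := by
    intro Z hZ
    refine BootstrapUV.ae_tendsto_of_abs_le_sum hd hm_top hm_order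
      (A := fun n => Finset.range n ×ˢ Finset.range n) (f := fun p ω => h (X p.1 ω) (X p.2 ω))
      -- Diagonal and off-diagonal pairs have different laws, hence the two moments.
      (K := max (∫ ω, |h (X 0 ω) (X 1 ω)| ^ (2 / d) ∂P) (∫ ω, |h (X 0 ω) (X 0 ω)| ^ (2 / d) ∂P))
      (fun a b hab => Finset.product_subset_product (Finset.range_mono hab)
        (Finset.range_mono hab))
      (fun n => by simp [sq])
      (le_max_of_le_left (integral_nonneg fun ω => by positivity)) ?_ ?_ hZ
    · rintro n ⟨i, j⟩ -
      rcases eq_or_ne i j with rfl | hij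
      · exact (hdiag i).integrable_iff.2 h_diag
      · exact (hoff i j hij).integrable_iff.2 h_mom
    · rintro n ⟨i, j⟩ -
      rcases eq_or_ne i j with rfl | hij
      · exact (hdiag i).integral_eq.le.trans (le_max_right _ _)
      · exact (hoff i j hij).integral_eq.le.trans (le_max_left _ _)
  refine ⟨hfull ?_, hfull ?_⟩
  · filter_upwards [hidx] with ω hω
    filter_upwards [hm2, eventually_ge_atTop 1] with n hmn hn
    exact BootstrapUV.abs_bootV_le h _ hmn (hω n hn)
  · refine ae_of_all _ fun ω => ?_
    filter_upwards [hm2] with n hmn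
    exact BootstrapUV.abs_bootVWeighted_le h _ _ hmn
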